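/- Let $(M,\omega)$ be a complex symplectic manifold, i.e. a complex manifold with a closed, nondegenerate holomorphic $2$-form $\omega$, and let $\mathcal J$ denote the complex structure operator on $TM$. Let $c=\omega^{-1}\in\Gamma(\bigwedge^2T^{1,0}M)\subset\Gamma(\bigwedge^2T^{\mathbb C}M)$ be the holomorphic Poisson bivector inverse to $\omega$, put $c_1=\operatorname{Re}c$, $c_2=\operatorname{Im}c$, and let $J=\{\lambda_1c_1+\lambda_2c_2:\lambda_1,\lambda_2\in\mathbb R\}$ be the associated holomorphic symplectic bihamiltonian structure. Let $p:M\to M'$ be a $C^\infty$ surjective submersion onto a $C^\infty$ manifold $M'$ with connected fibres, and let $\mathcal K$ be the foliation of $M$ by the fibres of $p$, so that $T_x\mathcal K=\ker p_{*,x}$. Assume that: (a) $J$ is projectable via $p$: for $i=1,2$ the bivector $c_i$ admits the push-forward, i.e. $\bigwedge^2p_*(c_i(x))$ depends, locally on $M$, only on $p(x)$, so that $c_i'(p(x))=\bigwedge^2p_*(c_i(x))$ is a well-defined bivector field on $M'$; and $c_1',c_2'$ are either linearly independent over $\mathbb R$ or both zero. The reduction of $J$ is $J'=\operatorname{Span}_{\mathbb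 R}\{c_1',c_2'\}$. (b) $\mathcal K$ is completely real: $T_x\mathcal K\oplus\mathcal J\,T_x\mathcal K=T_xM$ for every $x\in M$. For a bivector $b$ at a point, $\operatorname{rank}b$ is the rank of the map $\alpha\mapsto b(\alpha,\cdot)$ from covectors to vectors. Put $R_0'=\max_{b\in J'}\max_{x'\in M'}\operatorname{rank}b(x')$ and $(J')^{\mathbb C}=\operatorname{Span}_{\mathbb C}\{c_1',c_2'\}$. The structure $J'$ is called complete at $x'\in M'$ if $\operatorname{rank}_{\mathbb C}b(x')=R_0'$ for every $b\in (J')^{\mathbb C}\setminus\{0\}$, and complete if it is complete at every point of some open dense subset of $M'$. Then: if $J'$ is nontrivial, i.e. $J'\neq\{0\}$, then $J'$ is not complete. -/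

import Mathlib

open Set Topology
open scoped Manifold ContDiff

noncomputable section

/-! ### Bivectors on a real vector space -/

/-- `𝕜`-valued covectors on a real vector space `V`: the dual `V*` for `𝕜 = ℝ`, and the dual
`(V^ℂ)*` of the complexification for `𝕜 = ℂ` (a complex functional on `V^ℂ` is determined by its
restriction to `V`, an arbitrary real-linear map `V → ℂ`). -/
abbrev Covector (𝕜 : Type*) [RCLike 𝕜] (V : Type*) [AddCommGroup V] [Module ℝ V] : Type _ :=
  V →ₗ[ℝ] 𝕜

/-- Bivectors on `V` with coefficients in `𝕜`: elements of `⋀² V` for `𝕜 = ℝ` and of `⋀² (V^ℂ)` for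
`𝕜 = ℂ`, seen (`V` being finite-dimensional) as alternating bilinear forms on covectors. As a map
into the bidual, such a form `c` is the sharp map `c♯ α = c(α, ·)`. -/
def Bivector (𝕜 : Type*) [RCLike 𝕜] (V : Type*) [AddCommGroup V] [Module ℝ V] :
    Submodule 𝕜 (Covector 𝕜 V →ₗ[𝕜] Covector 𝕜 V →ₗ[𝕜] 𝕜) where
  carrier := {c | c.IsAlt}
  add_mem' {a b} ha hb := fun α => by simp [ha.self_eq_zero α, hb.self_eq_zero α]
  zero_mem' := fun α => by simp
  smul_mem' t a ha := fun α => by simp [ha.self_eq_zero α]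

namespace Bivector

section

variable {𝕜 : Type*} [RCLike 𝕜] {V W : Type*} [AddCommGroup V] [Module ℝ V]
  [AddCommGroup W] [Module ℝ W]

/-- The rank of a bivector: the dimension over `𝕜` of the image of its sharp map. -/
def rank (c : Bivector 𝕜 V) : ℕ :=
  Module.finrank 𝕜 (LinearMap.range c.1)

/-- The transpose of a linear map `f : V → W` on covectors. -/
def transpose (𝕜 : Type*) [RCLike 𝕜] (f : V →ₗ[ℝ] W) : Covector 𝕜 W →ₗ[𝕜] Covector 𝕜 V where
  toFun α := α ∘ₗ f
  map_add' _ _ := rfl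
  map_smul' _ _ := rfl

/-- The map `⋀² f` on bivectors induced by a linear map `f`. -/
def map (f : V →ₗ[ℝ] W) (c : Bivector 𝕜 V) : Bivector 𝕜 W :=
  ⟨c.1.compl₁₂ (transpose 𝕜 f) (transpose 𝕜 f), fun α => c.2 (transpose 𝕜 f α)⟩

end

section Complex

variable {V : Type*} [AddCommGroup V] [Module ℝ V]

/-- A real covector seen as a complex one. -/
def covectorOfReal : Covector ℝ V →ₗ[ℝ] Covector ℂ V where
  toFun α := Complex.ofRealCLM.toLinearMap ∘ₗ α
  map_add' α β := by ext v; simp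
  map_smul' t α := by ext v; simp

/-- The real part of a complex covector. -/
def covectorRe : Covector ℂ V →ₗ[ℝ] Covector ℝ V where
  toFun α := Complex.reLm ∘ₗ α
  map_add' α β := by ext v; simp
  map_smul' t α := by ext v; simp

/-- The imaginary part of a complex covector. -/
def covectorIm : Covector ℂ V →ₗ[ℝ] Covector ℝ V where
  toFun α := Complex.imLm ∘ₗ α
  map_add' α β := by ext v; simp
  map_smul' t α := by ext v; simp

/-- The real part of a complex bivector. -/
def re (c : Bivector ℂ V) : Bivector ℝ V :=
  ⟨LinearMap.mk₂ ℝ (fun α β => (c.1 (covectorOfReal α) (covectorOfReal β)).re)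
    (by intros; simp) (by intros; simp) (by intros; simp) (by intros; simp),
   fun α => by simp [c.2.self_eq_zero]⟩

/-- The imaginary part of a complex bivector. -/
def im (c : Bivector ℂ V) : Bivector ℝ V :=
  ⟨LinearMap.mk₂ ℝ (fun α β => (c.1 (covectorOfReal α) (covectorOfReal β)).im)
    (by intros; simp) (by intros; simp) (by intros; simp) (by intros; simp),
   fun α => by simp [c.2.self_eq_zero]⟩

lemma covectorRe_smul (t : ℂ) (α : Covector ℂ V) :
    covectorRe (t • α) = t.re • covectorRe α - t.im • covectorIm α := by
  ext v; simp [covectorRe, covectorIm]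

lemma covectorIm_smul (t : ℂ) (α : Covector ℂ V) :
    covectorIm (t • α) = t.re • covectorIm α + t.im • covectorRe α := by
  ext v; simp [covectorRe, covectorIm]

/-- A real bivector seen as a complex one, by complex-bilinear extension. -/
def complexify (c : Bivector ℝ V) : Bivector ℂ V :=
  ⟨LinearMap.mk₂ ℂ (fun α β =>
      (⟨c.1 (covectorRe α) (covectorRe β) - c.1 (covectorIm α) (covectorIm β),
        c.1 (covectorRe α) (covectorIm β) + c.1 (covectorIm α) (covectorRe β)⟩ : ℂ))
    (by intros; apply Complex.ext <;> simp <;> ring)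
    (by intros; apply Complex.ext <;> simp [covectorRe_smul, covectorIm_smul] <;> ring)
    (by intros; apply Complex.ext <;> simp <;> ring)
    (by intros; apply Complex.ext <;> simp [covectorRe_smul, covectorIm_smul] <;> ring),
   fun α => by
    have h := c.2.neg (covectorRe α) (covectorIm α)
    apply Complex.ext <;> simp [c.2.self_eq_zero, ← h]⟩

end Complex

section Inverse

variable {V : Type*} [AddCommGroup V] [Module ℝ V] [Module ℂ V] [IsScalarTower ℝ ℂ V]

/-- The `(1,0)`-part `α^{1,0}(v) = (α(v) - i α(i v)) / 2` of a complex covector, a complex-linear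
functional on `V`. This is the restriction of `α` to `V^{1,0} = {v - i 𝒥 v}`, under the
complex-linear isomorphism `V ≅ V^{1,0}`, `v ↦ (v - i 𝒥 v) / 2`. -/
def covector10 : Covector ℂ V →ₗ[ℂ] Module.Dual ℂ V where
  toFun α :=
    { toFun := fun v => (α v - Complex.I * α (Complex.I • v)) / 2
      map_add' := fun v w => by simp only [smul_add, map_add]; ring
      map_smul' := fun t v => by
        have key : ∀ u : V, α (t • u) = t.re * α u + t.im * α (Complex.I • u) := by
          intro u
          have : t • u = t.re • u + t.im • (Complex.I • u) := by
            conv_lhs => rw [← Complex.re_add_im t]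
            rw [add_smul, mul_smul, ← algebraMap_smul ℂ t.re u,
              ← algebraMap_smul ℂ t.im (Complex.I • u)]
            rfl
          rw [this, map_add, map_smul, map_smul, Complex.real_smul, Complex.real_smul]
        have h2 : Complex.I • t • v = t • Complex.I • v := smul_comm _ _ _
        have h3 : Complex.I • Complex.I • v = -v := by
          rw [smul_smul, Complex.I_mul_I, neg_one_smul]
        rw [h2, key v, key (Complex.I • v), h3, map_neg, RingHom.id_apply, smul_eq_mul]
        conv_rhs => rw [← Complex.re_add_im t]
        linear_combination ((t.im : ℂ) * α (Complex.I • v) / 2) * Complex.I_sq }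
  map_add' α β := by ext v; simp; ring
  map_smul' t α := by ext v; simp; ring

variable [FiniteDimensional ℂ V]

/-- The isomorphism `V → V*`, `v ↦ w(v, ·)` given by a nondegenerate complex-bilinear form. -/
def flat (w : V →ₗ[ℂ] V →ₗ[ℂ] ℂ) (hw : LinearMap.ker w = ⊥) : V ≃ₗ[ℂ] Module.Dual ℂ V :=
  LinearMap.linearEquivOfInjective w (LinearMap.ker_eq_bot.1 hw) Subspace.dual_finrank_eq.symm

/-- The complex bivector of type `(2,0)` inverse to a nondegenerate alternating complex-bilinear
form `w` on `V ≅ V^{1,0}`: it depends only on the `(1,0)`-parts of its arguments, and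
`c(w(u, ·), w(v, ·)) = w(u, v)`. -/
def inverse (w : V →ₗ[ℂ] V →ₗ[ℂ] ℂ) (hw : LinearMap.ker w = ⊥) (halt : w.IsAlt) : Bivector ℂ V :=
  ⟨w.compl₁₂ ((flat w hw).symm.toLinearMap ∘ₗ covector10)
      ((flat w hw).symm.toLinearMap ∘ₗ covector10), fun _ => halt _⟩

end Inverse

end Bivector

/-- A continuous alternating `2`-form as a bilinear form. -/
def bilinOfForm {E : Type*} [TopologicalSpace E] [AddCommGroup E] [Module ℂ E]
    (w : E [⋀^Fin 2]→L[ℂ] ℂ) : E →ₗ[ℂ] E →ₗ[ℂ] ℂ :=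
  LinearMap.mk₂ ℂ (fun u v => w ![u, v])
    (fun _ _ _ => w.toAlternatingMap.map_vecCons_add _ _ _)
    (fun _ _ _ => w.toAlternatingMap.map_vecCons_smul _ _ _)
    (fun u v v' => by
      have h := w.toMultilinearMap.map_update_add ![u, 0] 1 v v'
      have e : ∀ a : E, Function.update ![u, 0] 1 a = ![u, a] := fun a => by
        ext i; fin_cases i <;> simp
      rwa [e, e, e] at h)
    (fun t u v => by
      have h := w.toMultilinearMap.map_update_smul ![u, 0] 1 t v
      have e : ∀ a : E, Function.update ![u, 0] 1 a = ![u, a] := fun a => by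
        ext i; fin_cases i <;> simp
      rwa [e, e] at h)

lemma bilinOfForm_isAlt {E : Type*} [TopologicalSpace E] [AddCommGroup E] [Module ℂ E]
    (w : E [⋀^Fin 2]→L[ℂ] ℂ) : (bilinOfForm w).IsAlt := fun u =>
  w.map_eq_zero_of_eq ![u, u] (i := 0) (j := 1) rfl (by decide)

/-! ### Bivector fields, bihamiltonian structures and completeness -/

section Fields

variable (𝕜 : Type*) [RCLike 𝕜] (E : Type*) [NormedAddCommGroup E] [NormedSpace ℝ E]
  (M : Type*) [TopologicalSpace M] [ChartedSpace E M]

/-- Real (`𝕜 = ℝ`) or complex (`𝕜 = ℂ`) bivector fields on a manifold `M` modelled on `E`. -/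
abbrev BivectorField : Type _ := ∀ x : M, Bivector 𝕜 (TangentSpace 𝓘(ℝ, E) x)

end Fields

section Complete

variable {E : Type*} [NormedAddCommGroup E] [NormedSpace ℝ E]
  {M : Type*} [TopologicalSpace M] [ChartedSpace E M]

/-- The real family `J` of bivector fields generated by a pair `c₁, c₂`. -/
def pencil (c₁ c₂ : BivectorField ℝ E M) : Submodule ℝ (BivectorField ℝ E M) :=
  Submodule.span ℝ {c₁, c₂}

/-- The complexification `J^ℂ` of a family `J` of real bivector fields. -/
def complexification (J : Submodule ℝ (BivectorField ℝ E M)) :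
    Submodule ℂ (BivectorField ℂ E M) :=
  Submodule.span ℂ {d | ∃ c ∈ J, d = fun x => Bivector.complexify (c x)}

/-- The maximal rank `R₀ = max_{c ∈ J} max_{x ∈ M} rank c(x)` of the bivectors of `J`. -/
def maxRank (J : Submodule ℝ (BivectorField ℝ E M)) : ℕ :=
  sSup {r : ℕ | ∃ c ∈ J, ∃ x : M, r = Bivector.rank (c x)}

/-- `J` is complete at `x`: every nonzero element of `J^ℂ` has rank `R₀` at `x`. -/
def IsCompleteStructureAt (J : Submodule ℝ (BivectorField ℝ E M)) (x : M) : Prop :=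
  ∀ d ∈ complexification J, d ≠ 0 → Bivector.rank (d x) = maxRank J

/-- `J` is complete: it is complete at every point of some open dense subset of `M`. -/
def IsCompleteStructure (J : Submodule ℝ (BivectorField ℝ E M)) : Prop :=
  ∃ U : Set M, IsOpen U ∧ Dense U ∧ ∀ x ∈ U, IsCompleteStructureAt J x

end Complete

/-! ### Reduction along the fibres of a submersion -/

section Reduction

variable {E : Type*} [NormedAddCommGroup E] [NormedSpace ℝ E]
  {M : Type*} [TopologicalSpace M] [ChartedSpace E M]
  {E' : Type*} [NormedAddCommGroup E'] [NormedSpace ℝ E']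
  {M' : Type*} [TopologicalSpace M'] [ChartedSpace E' M']

variable (E E') in
/-- `p` is a `C^∞` surjective submersion with connected fibres. The leaves of the foliation `𝒦`
on `M` defined by `p` are the fibres of `p`. -/
structure IsFibration (p : M → M') : Prop where
  smooth : ContMDiff 𝓘(ℝ, E) 𝓘(ℝ, E') ∞ p
  surjective : Function.Surjective p
  submersion : ∀ x : M, Function.Surjective (mfderiv 𝓘(ℝ, E) 𝓘(ℝ, E') p x)
  connected : ∀ x' : M', IsConnected (p ⁻¹' {x'})

variable (E E') in
/-- The tangent space `T_x 𝒦 = ker p_{*,x}` to the leaf through `x` of the foliation `𝒦`. -/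
def leafTangent (p : M → M') (x : M) : Submodule ℝ (TangentSpace 𝓘(ℝ, E) x) :=
  LinearMap.ker (mfderiv 𝓘(ℝ, E) 𝓘(ℝ, E') p x).toLinearMap

/-- The value `⋀² p_* (Z(x))`, a bivector at the point `p x` of `M'`. -/
def pushAt {𝕜 : Type*} [RCLike 𝕜] (p : M → M') (Z : BivectorField 𝕜 E M) (x : M) :
    Bivector 𝕜 (TangentSpace 𝓘(ℝ, E') (p x)) :=
  Bivector.map (mfderiv 𝓘(ℝ, E) 𝓘(ℝ, E') p x).toLinearMap (Z x)

variable (E') in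
/-- `Z` is projectable (admits the push-forward): locally on `M` it is of the form
`Z = Z'(y) + Z̃(x, y)` where `Z'` depends only on the coordinates `y` constant on the leaves, i.e.
comes from the base, and `Z̃` is killed by `⋀² p_*`. -/
def IsProjectable (p : M → M') (Z : BivectorField ℝ E M) : Prop :=
  ∀ x : M, ∃ U ∈ 𝓝 x, ∃ Z' : BivectorField ℝ E' M', ∀ y ∈ U, pushAt p Z y = Z' (p y)

/-- The push-forward `Z'(x') = ⋀² p_* (Z(x))`, where `x` is any point of the fibre over `x'`.
(The value is independent of `x` if `Z` is projectable and the fibres are connected.) -/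
def pushforward (p : M → M') (hp : Function.Surjective p) (Z : BivectorField ℝ E M) :
    BivectorField ℝ E' M' :=
  fun x' => Function.surjInv_eq hp x' ▸ pushAt p Z (Function.surjInv hp x')

variable (E') in
/-- The bihamiltonian structure generated by `c₁, c₂` is projectable via `p`: both bivector fields
are, and their push-forwards are linearly independent or both zero. -/
def IsProjectablePair (p : M → M') (hp : Function.Surjective p)
    (c₁ c₂ : BivectorField ℝ E M) : Prop :=
  IsProjectable E' p c₁ ∧ IsProjectable E' p c₂ ∧
    (LinearIndependent ℝ ![(pushforward p hp c₁ : BivectorField ℝ E' M'), pushforward p hp c₂] ∨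
      ((pushforward p hp c₁ : BivectorField ℝ E' M') = 0 ∧
        (pushforward p hp c₂ : BivectorField ℝ E' M') = 0))

/-- The reduction `J'` of the structure `J` generated by `c₁, c₂`: the family of bivector fields
on `M'` generated by the push-forwards of `c₁, c₂`. -/
def reduction (p : M → M') (hp : Function.Surjective p) (c₁ c₂ : BivectorField ℝ E M) :
    Submodule ℝ (BivectorField ℝ E' M') :=
  pencil (pushforward p hp c₁) (pushforward p hp c₂)

end Reduction

/-! ### Complex symplectic manifolds -/

section Symplectic

variable {E : Type*} [NormedAddCommGroup E] [NormedSpace ℂ E]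
  {M : Type*} [TopologicalSpace M] [ChartedSpace E M]

/-- The coordinate expression of a `(2,0)`-form on `M` in the preferred chart at `x₀`: its
pull-back under the inverse of the chart. -/
def formInChart (Ω : ∀ x : M, TangentSpace 𝓘(ℂ, E) x [⋀^Fin 2]→L[ℂ] ℂ) (x₀ : M) (y : E) :
    E [⋀^Fin 2]→L[ℂ] ℂ :=
  (Ω ((chartAt E x₀).symm y)).compContinuousLinearMap
    (mfderiv 𝓘(ℂ, E) 𝓘(ℂ, E) (chartAt E x₀).symm y)

/-- `Ω` is a holomorphic symplectic form: holomorphic, closed and nondegenerate. -/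
structure IsHolomorphicSymplectic
    (Ω : ∀ x : M, TangentSpace 𝓘(ℂ, E) x [⋀^Fin 2]→L[ℂ] ℂ) : Prop where
  holomorphic : ∀ x₀ : M, DifferentiableOn ℂ (formInChart Ω x₀) (chartAt E x₀).target
  closed : ∀ x₀ : M, ∀ y ∈ (chartAt E x₀).target, extDeriv (formInChart Ω x₀) y = 0
  nondegenerate : ∀ x : M, LinearMap.ker (bilinOfForm (Ω x)) = ⊥

/-- The holomorphic bivector field `c = Ω⁻¹`. -/
def inverseField [FiniteDimensional ℂ E]
    (Ω : ∀ x : M, TangentSpace 𝓘(ℂ, E) x [⋀^Fin 2]→L[ℂ] ℂ)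
    (hΩ : IsHolomorphicSymplectic Ω) : BivectorField ℂ E M :=
  fun x => Bivector.inverse (V := E) (bilinOfForm (Ω x)) (hΩ.nondegenerate x)
    (bilinOfForm_isAlt (Ω x))

/-- `c₁ = Re Ω⁻¹`, the first of the two generators of the holomorphic symplectic bihamiltonian
structure `J` of `(M, Ω)`. -/
def reInverseField [FiniteDimensional ℂ E]
    (Ω : ∀ x : M, TangentSpace 𝓘(ℂ, E) x [⋀^Fin 2]→L[ℂ] ℂ)
    (hΩ : IsHolomorphicSymplectic Ω) : BivectorField ℝ E M :=
  fun x => Bivector.re (inverseField Ω hΩ x)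

/-- `c₂ = Im Ω⁻¹`, the second generator. -/
def imInverseField [FiniteDimensional ℂ E]
    (Ω : ∀ x : M, TangentSpace 𝓘(ℂ, E) x [⋀^Fin 2]→L[ℂ] ℂ)
    (hΩ : IsHolomorphicSymplectic Ω) : BivectorField ℝ E M :=
  fun x => Bivector.im (inverseField Ω hΩ x)

/-- The complex structure `𝒥` of the tangent space `T_x M`: multiplication by `i`. -/
def complexStructure (x : M) : TangentSpace 𝓘(ℝ, E) x →ₗ[ℝ] TangentSpace 𝓘(ℝ, E) x :=
  (LinearMap.lsmul ℂ E Complex.I).restrictScalars ℝ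

variable {E' : Type*} [NormedAddCommGroup E'] [NormedSpace ℝ E']
  {M' : Type*} [TopologicalSpace M'] [ChartedSpace E' M']

variable (E E') in
/-- The foliation `𝒦` by the fibres of `p` is completely real:
`T_x 𝒦 ⊕ 𝒥 T_x 𝒦 = T_x M` for every `x`. -/
def IsCompletelyReal (p : M → M') : Prop :=
  ∀ x : M, IsCompl (leafTangent E E' p x) ((leafTangent E E' p x).map (complexStructure x))

end Symplectic

end

/-!
If `T_x𝒦` is completely real, then `p_*` maps `T^{1,0}_x M` isomorphically onto the complexified
tangent space of `M'`. Hence it carries the nondegenerate bivector `c = c₁ + i c₂` of `⋀² T^{1,0}M`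
to a bivector `c₁' + i c₂'` of maximal rank `dim M'` at every point. On the other hand, over `ℂ`
a two-dimensional pencil of square matrices always contains a nonzero singular one, so the rank
cannot be constant on the nonzero elements of `(J')^ℂ`, at any point of `M'`.
-/

lemma smul_add_smul_ne_zero {R M : Type*} [Semiring R] [AddCommMonoid M] [Module R M] {x y : M}
    (hxy : LinearIndependent R ![x, y]) {a b : R} (hab : a ≠ 0 ∨ b ≠ 0) :
    a • x + b • y ≠ 0 := fun h =>
  have ⟨ha, hb⟩ := hxy.eq_zero_of_pair h
  hab.elim (· ha) (· hb)

lemma exists_not_injective_combination {K W W' : Type*} [Field K] [IsAlgClosed K]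
    [AddCommGroup W] [Module K W] [FiniteDimensional K W] [Nontrivial W]
    [AddCommGroup W'] [Module K W'] [FiniteDimensional K W']
    (hdim : Module.finrank K W = Module.finrank K W') (A B : W →ₗ[K] W') :
    ∃ a b : K, (a ≠ 0 ∨ b ≠ 0) ∧ ¬ Function.Injective (a • A + b • B) := by
  by_cases hB : Function.Injective B
  · let e := LinearMap.linearEquivOfInjective B hB hdim
    obtain ⟨t, ht⟩ := Module.End.exists_eigenvalue (e.symm.toLinearMap ∘ₗ A)
    obtain ⟨u, hu⟩ := ht.exists_hasEigenvector
    have hAu : A u = t • B u := by simpa [e] using congrArg e hu.apply_eq_smul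
    refine ⟨1, -t, Or.inl one_ne_zero, fun hinj => hu.2 (hinj ?_)⟩
    simp [hAu]
  · exact ⟨0, 1, Or.inr one_ne_zero, by simpa using hB⟩

/-- A real subspace `K` of a complex vector space `V` is completely real if `K ⊕ iK = V`. This is
the pointwise form of `IsCompletelyReal`. -/
def IsCompletelyRealSubspace {V : Type*} [AddCommGroup V] [Module ℝ V] [Module ℂ V]
    [IsScalarTower ℝ ℂ V] (K : Submodule ℝ V) : Prop :=
  IsCompl K (K.map ((LinearMap.lsmul ℂ V Complex.I).restrictScalars ℝ))

lemma IsCompletelyRealSubspace.exists_eq_add_I_smul {V : Type*} [AddCommGroup V] [Module ℝ V]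
    [Module ℂ V] [IsScalarTower ℝ ℂ V] {K : Submodule ℝ V} (hK : IsCompletelyRealSubspace K)
    (v : V) : ∃ k ∈ K, ∃ k' ∈ K, v = k + Complex.I • k' := by
  obtain ⟨k, hk, -, ⟨k', hk', rfl⟩, hv⟩ :=
    Submodule.mem_sup.1 (hK.sup_eq_top.ge (Submodule.mem_top (x := v)))
  exact ⟨k, hk, k', hk', hv.symm⟩

namespace Bivector

section Rank

variable {𝕜 : Type*} [RCLike 𝕜] {V : Type*} [AddCommGroup V] [Module ℝ V]
  [FiniteDimensional ℝ V]

lemma rank_eq_finrank_covector_iff {c : Bivector 𝕜 V} :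
    rank c = Module.finrank 𝕜 (Covector 𝕜 V) ↔ Function.Injective c.1 := by
  rw [← LinearMap.ker_eq_bot, ← Submodule.finrank_eq_zero, rank,
    ← LinearMap.finrank_range_add_finrank_ker c.1]
  exact left_eq_add

lemma rank_le_finrank_covector (c : Bivector 𝕜 V) :
    rank c ≤ Module.finrank 𝕜 (Covector 𝕜 V) :=
  LinearMap.finrank_range_le c.1

end Rank

section Transpose

variable {𝕜 : Type*} [RCLike 𝕜] {V W : Type*} [AddCommGroup V] [Module ℝ V]
  [AddCommGroup W] [Module ℝ W] {f : V →ₗ[ℝ] W}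

lemma transpose_injective (hf : Function.Surjective f) :
    Function.Injective (transpose 𝕜 f) :=
  fun _ _ h => (LinearMap.cancel_right hf).1 h

lemma mem_range_transpose_of_ker_le (hf : Function.Surjective f) {γ : Covector 𝕜 V}
    (hγ : LinearMap.ker f ≤ LinearMap.ker γ) : γ ∈ LinearMap.range (transpose 𝕜 f) := by
  refine ⟨(LinearMap.ker f).liftQ γ hγ ∘ₗ (f.quotKerEquivOfSurjective hf).symm, ?_⟩
  ext v
  have hv : (f.quotKerEquivOfSurjective hf).symm (f v) = (LinearMap.ker f).mkQ v :=
    (LinearEquiv.symm_apply_eq _).2 rfl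
  simp [transpose, hv]

end Transpose

section Complexification

variable {V : Type*} [AddCommGroup V] [Module ℝ V]

lemma covectorOfReal_re_add_im (γ : Covector ℂ V) :
    covectorOfReal (covectorRe γ) + Complex.I • covectorOfReal (covectorIm γ) = γ := by
  ext v
  apply Complex.ext <;> simp [covectorOfReal, covectorRe, covectorIm]

lemma covectorRe_ofReal (α : Covector ℝ V) : covectorRe (covectorOfReal α) = α := by
  ext v
  simp [covectorOfReal, covectorRe]

lemma covectorIm_ofReal (α : Covector ℝ V) : covectorIm (covectorOfReal α) = 0 := by
  ext
  simp [covectorOfReal, covectorIm]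

lemma complexify_apply_ofReal (c : Bivector ℝ V) (α β : Covector ℝ V) :
    (complexify c).1 (covectorOfReal α) (covectorOfReal β) = (c.1 α β : ℂ) := by
  apply Complex.ext <;> simp [complexify, covectorRe_ofReal, covectorIm_ofReal]

lemma complexify_re_add_im (c : Bivector ℂ V) :
    complexify (re c) + Complex.I • complexify (im c) = c := by
  ext α β
  conv_rhs => rw [← covectorOfReal_re_add_im α, ← covectorOfReal_re_add_im β]
  simp only [map_add, map_smul, LinearMap.add_apply, LinearMap.smul_apply, smul_eq_mul]
  apply Complex.ext <;> simp [complexify, re, im] <;> ring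

lemma complexify_map_re_add_im {W : Type*} [AddCommGroup W] [Module ℝ W] (f : V →ₗ[ℝ] W)
    (c : Bivector ℂ V) :
    complexify (map f (re c)) + Complex.I • complexify (map f (im c)) = map f c :=
  congrArg (map f) (complexify_re_add_im c)

end Complexification

section CompletelyReal

variable {V : Type*} [AddCommGroup V] [Module ℝ V] [Module ℂ V] [IsScalarTower ℝ ℂ V]
  {W : Type*} [AddCommGroup W] [Module ℝ W]

lemma mem_ker_covector10_iff {γ : Covector ℂ V} :
    γ ∈ LinearMap.ker (covector10 (V := V)) ↔
      ∀ v, γ (Complex.I • v) = -(Complex.I * γ v) := by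
  have h (v : V) : covector10 γ v = 0 ↔ γ (Complex.I • v) = -(Complex.I * γ v) := by
    change (γ v - Complex.I * γ (Complex.I • v)) / 2 = 0 ↔ _
    constructor <;> intro hv
    · linear_combination 2 * Complex.I * hv + γ (Complex.I • v) * Complex.I_sq
    · rw [hv]
      linear_combination γ v / 2 * Complex.I_sq
  exact LinearMap.ext_iff.trans (forall_congr' h)

lemma exists_mem_ker_covector10_eqOn {K : Submodule ℝ V} (hK : IsCompletelyRealSubspace K)
    (γ : Covector ℂ V) : ∃ δ ∈ LinearMap.ker (covector10 (V := V)), ∀ k ∈ K, δ k = γ k := by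
  let i : V →ₗ[ℝ] V := (LinearMap.lsmul ℂ V Complex.I).restrictScalars ℝ
  -- The antilinear extension of `γ|K` is forced: `δ (k + i k') = γ k - i γ k'`.
  let δ : Covector ℂ V := LinearMap.ofIsCompl hK (γ.domRestrict K)
    ((Complex.I • γ ∘ₗ i).domRestrict (K.map i))
  have h_left : ∀ k ∈ K, δ k = γ k := fun k hk => LinearMap.ofIsCompl_apply_left hK ⟨k, hk⟩
  have h_right : ∀ k ∈ K, δ (Complex.I • k) = -(Complex.I * γ k) := fun k hk => by
    have h := LinearMap.ofIsCompl_apply_right hK (φ := γ.domRestrict K)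
      (ψ := (Complex.I • γ ∘ₗ i).domRestrict (K.map i)) ⟨i k, k, hk, rfl⟩
    refine h.trans ?_
    simp [i, smul_smul]
  refine ⟨δ, mem_ker_covector10_iff.2 fun v => ?_, h_left⟩
  obtain ⟨k, hk, k', hk', rfl⟩ := hK.exists_eq_add_I_smul v
  rw [smul_add, smul_smul, Complex.I_mul_I, neg_one_smul, map_add, map_add, map_neg,
    h_left k hk, h_left k' hk', h_right k hk, h_right k' hk']
  linear_combination -γ k' * Complex.I_sq

lemma isCompl_range_transpose_ker_covector10 {f : V →ₗ[ℝ] W} (hf : Function.Surjective f)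
    (hK : IsCompletelyRealSubspace (LinearMap.ker f)) :
    IsCompl (LinearMap.range (transpose ℂ f)) (LinearMap.ker (covector10 (V := V))) := by
  constructor
  · rw [Submodule.disjoint_def]
    rintro _ ⟨α, rfl⟩ hα
    have hker : ∀ k ∈ LinearMap.ker f, transpose ℂ f α k = 0 := fun k hk => by
      simp [transpose, LinearMap.mem_ker.1 hk]
    ext v
    obtain ⟨k, hk, k', hk', rfl⟩ := hK.exists_eq_add_I_smul v
    rw [map_add, mem_ker_covector10_iff.1 hα, hker k hk, hker k' hk']
    simp
  · rw [codisjoint_iff, eq_top_iff]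
    intro γ _
    obtain ⟨δ, hδ, hδγ⟩ := exists_mem_ker_covector10_eqOn hK γ
    have hγδ : γ - δ ∈ LinearMap.range (transpose ℂ f) :=
      mem_range_transpose_of_ker_le hf fun k hk => by simp [hδγ k hk]
    exact Submodule.mem_sup.2 ⟨γ - δ, hγδ, δ, hδ, sub_add_cancel γ δ⟩

/-- A complex bivector on a finite-dimensional complex space `V` is nondegenerate of type `(2,0)`
if it lies in `⋀² V^{1,0}` and is nondegenerate there. Equivalently, as encoded here, its sharp map
kills exactly the covectors whose `(1,0)`-part vanishes. -/
def IsNondegenerate20 (c : Bivector ℂ V) : Prop :=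
  LinearMap.ker c.1 = LinearMap.ker (covector10 (V := V))

lemma covector10_surjective : Function.Surjective (covector10 (V := V)) := by
  intro φ
  refine ⟨φ.restrictScalars ℝ, ?_⟩
  ext v
  change (φ v - Complex.I * φ (Complex.I • v)) / 2 = φ v
  rw [map_smul, smul_eq_mul]
  linear_combination -φ v / 2 * Complex.I_sq

lemma isNondegenerate20_inverse [FiniteDimensional ℂ V] (w : V →ₗ[ℂ] V →ₗ[ℂ] ℂ)
    (hw : LinearMap.ker w = ⊥) (halt : w.IsAlt) : IsNondegenerate20 (inverse w hw halt) := by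
  have hsurj : Function.Surjective ((flat w hw).symm.toLinearMap ∘ₗ covector10) :=
    (flat w hw).symm.surjective.comp covector10_surjective
  ext γ
  have hγ : (inverse w hw halt).1 γ = 0 ↔ w ((flat w hw).symm (covector10 γ)) = 0 := by
    refine ⟨fun h => ?_, fun h => ?_⟩
    · ext v
      obtain ⟨δ, rfl⟩ := hsurj v
      exact LinearMap.congr_fun h δ
    · ext δ
      exact LinearMap.congr_fun h _
  rw [LinearMap.mem_ker, LinearMap.mem_ker, hγ, ← LinearMap.mem_ker, hw, Submodule.mem_bot,
    LinearEquiv.map_eq_zero_iff]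

lemma IsNondegenerate20.map_injective {c : Bivector ℂ V} (hc : IsNondegenerate20 c)
    {f : V →ₗ[ℝ] W} (hf : Function.Surjective f)
    (hK : IsCompletelyRealSubspace (LinearMap.ker f)) : Function.Injective (map f c).1 := by
  have hcompl : IsCompl (LinearMap.range (transpose ℂ f)) (LinearMap.ker c.1) :=
    hc ▸ isCompl_range_transpose_ker_covector10 hf hK
  rw [injective_iff_map_eq_zero]
  intro α hα
  have hker : c.1 (transpose ℂ f α) = 0 := by
    ext γ
    obtain ⟨_, ⟨β, rfl⟩, δ, hδ, rfl⟩ :=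
      Submodule.mem_sup.1 (hcompl.sup_eq_top.ge (Submodule.mem_top (x := γ)))
    have hβ : c.1 (transpose ℂ f α) (transpose ℂ f β) = 0 := LinearMap.congr_fun hα β
    rw [map_add, hβ, ← c.2.neg, LinearMap.mem_ker.1 hδ]
    simp
  have hzero := Submodule.disjoint_def.1 hcompl.disjoint _ ⟨α, rfl⟩ hker
  exact transpose_injective hf (hzero.trans (map_zero _).symm)

end CompletelyReal

end Bivector

section Completeness

variable {E : Type*} [NormedAddCommGroup E] [NormedSpace ℝ E]
  {M : Type*} [TopologicalSpace M] [ChartedSpace E M]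

/-- The pointwise complexification of a real bivector field: the fields of this form, for `c ∈ J`,
span `J^ℂ`. -/
noncomputable def complexifyField (c : BivectorField ℝ E M) : BivectorField ℂ E M :=
  fun x => Bivector.complexify (c x)

lemma complexifyField_mem_complexification {J : Submodule ℝ (BivectorField ℝ E M)}
    {c : BivectorField ℝ E M} (hc : c ∈ J) : complexifyField c ∈ complexification J :=
  Submodule.subset_span ⟨c, hc, rfl⟩

lemma linearIndependent_complexifyField {ι : Type*} {c : ι → BivectorField ℝ E M}
    (hc : LinearIndependent ℝ c) : LinearIndependent ℂ fun i => complexifyField (c i) := by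
  rw [linearIndependent_iff'ₛ] at hc ⊢
  intro s t t' htt' i hi
  have hsum (x : M) (α β : Covector ℝ (TangentSpace 𝓘(ℝ, E) x)) :
      ∑ j ∈ s, t j * ((c j x).1 α β : ℂ) = ∑ j ∈ s, t' j * ((c j x).1 α β : ℂ) := by
    simpa [complexifyField, Bivector.complexify_apply_ofReal] using
      congrArg (fun d : BivectorField ℂ E M =>
        (d x).1 (Bivector.covectorOfReal α) (Bivector.covectorOfReal β)) htt'
  have hre : ∑ j ∈ s, (t j).re • c j = ∑ j ∈ s, (t' j).re • c j := by
    ext x α β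
    simpa using congrArg Complex.re (hsum x α β)
  have him : ∑ j ∈ s, (t j).im • c j = ∑ j ∈ s, (t' j).im • c j := by
    ext x α β
    simpa using congrArg Complex.im (hsum x α β)
  exact Complex.ext (hc s _ _ hre i hi) (hc s _ _ him i hi)

lemma IsCompleteStructure.exists_isCompleteStructureAt
    {J : Submodule ℝ (BivectorField ℝ E M)} (h : IsCompleteStructure J) (hJ : J ≠ ⊥) :
    ∃ x, IsCompleteStructureAt J x := by
  obtain ⟨U, -, hdense, hU⟩ := h
  obtain ⟨c, -, hc⟩ := J.ne_bot_iff.1 hJ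
  obtain ⟨y, -⟩ := Function.ne_iff.1 hc
  have : Nonempty M := ⟨y⟩
  obtain ⟨x, hx⟩ := hdense.nonempty
  exact ⟨x, hU x hx⟩

lemma IsCompleteStructureAt.maxRank_lt [FiniteDimensional ℝ E]
    {J : Submodule ℝ (BivectorField ℝ E M)} {x : M} (hJ : IsCompleteStructureAt J x)
    {d₁ d₂ : BivectorField ℂ E M} (hd₁ : d₁ ∈ complexification J)
    (hd₂ : d₂ ∈ complexification J) (hli : LinearIndependent ℂ ![d₁, d₂]) :
    maxRank J < Module.finrank ℂ (Covector ℂ E) := by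
  have : FiniteDimensional ℝ (TangentSpace 𝓘(ℝ, E) x) := ‹FiniteDimensional ℝ E›
  have : Nontrivial (Covector ℂ (TangentSpace 𝓘(ℝ, E) x)) := by
    change Nontrivial (Covector ℂ E)
    by_contra hE
    rw [not_nontrivial_iff_subsingleton] at hE
    refine hli.ne_zero 0 (funext fun y => Subtype.ext (LinearMap.ext fun α => ?_))
    rw [show α = 0 from hE.elim (α : Covector ℂ E) 0, map_zero, map_zero]
  obtain ⟨a, b, hab, hdeg⟩ := exists_not_injective_combination
    Subspace.dual_finrank_eq.symm (d₁ x).1 (d₂ x).1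
  have hne : a • d₁ + b • d₂ ≠ 0 := smul_add_smul_ne_zero hli hab
  have hrank := hJ _ (add_mem (Submodule.smul_mem _ a hd₁) (Submodule.smul_mem _ b hd₂)) hne
  rw [← hrank]
  exact lt_of_le_of_ne (Bivector.rank_le_finrank_covector _)
    fun h => hdeg (Bivector.rank_eq_finrank_covector_iff.1 h)

lemma not_isCompleteStructureAt_pencil [FiniteDimensional ℝ E] {c₁ c₂ : BivectorField ℝ E M}
    (hli : LinearIndependent ℝ ![c₁, c₂]) {x : M}
    (hx : Function.Injective
      (Bivector.complexify (c₁ x) + Complex.I • Bivector.complexify (c₂ x)).1) :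
    ¬ IsCompleteStructureAt (pencil c₁ c₂) x := by
  intro hJ
  have hd₁ : complexifyField c₁ ∈ complexification (pencil c₁ c₂) :=
    complexifyField_mem_complexification (Submodule.subset_span (by simp))
  have hd₂ : complexifyField c₂ ∈ complexification (pencil c₁ c₂) :=
    complexifyField_mem_complexification (Submodule.subset_span (by simp))
  have hliℂ : LinearIndependent ℂ ![complexifyField c₁, complexifyField c₂] := by
    convert linearIndependent_complexifyField hli using 1
    ext i : 1
    fin_cases i <;> rfl
  have hne : complexifyField c₁ + Complex.I • complexifyField c₂ ≠ 0 := by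
    simpa using smul_add_smul_ne_zero hliℂ (a := 1) (b := Complex.I) (Or.inl one_ne_zero)
  have hrank := hJ _ (add_mem hd₁ (Submodule.smul_mem _ Complex.I hd₂)) hne
  exact (hJ.maxRank_lt hd₁ hd₂ hliℂ).ne
    (hrank.symm.trans (Bivector.rank_eq_finrank_covector_iff (V := E) |>.2 hx))

end Completeness

section Reduction

variable {E' : Type*} [NormedAddCommGroup E'] [NormedSpace ℝ E']
  {M' : Type*} [TopologicalSpace M'] [ChartedSpace E' M']

lemma exists_pushforward_eq_pushAt {E : Type*} [NormedAddCommGroup E] [NormedSpace ℝ E]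
    {M : Type*} [TopologicalSpace M] [ChartedSpace E M] {p : M → M'}
    (hp : Function.Surjective p) (x' : M') :
    ∃ (x : M) (h : p x = x'), ∀ Z : BivectorField ℝ E M,
      (pushforward p hp Z : BivectorField ℝ E' M') x' = h ▸ pushAt p Z x :=
  ⟨Function.surjInv hp x', Function.surjInv_eq hp x', fun _ => rfl⟩

variable {E : Type*} [NormedAddCommGroup E] [NormedSpace ℂ E]
  {M : Type*} [TopologicalSpace M] [ChartedSpace E M]

/-- The complex vector space structure of `T_x M`, whose multiplication by `i` is
`complexStructure x`. -/
local instance tangentSpaceModuleComplex (x : M) : Module ℂ (TangentSpace 𝓘(ℝ, E) x) :=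
  inferInstanceAs (Module ℂ E)

local instance tangentSpaceIsScalarTower (x : M) :
    IsScalarTower ℝ ℂ (TangentSpace 𝓘(ℝ, E) x) :=
  inferInstanceAs (IsScalarTower ℝ ℂ E)

lemma complexify_pushAt_re_add_im_injective {p : M → M'} {x : M}
    (hp : Function.Surjective (mfderiv 𝓘(ℝ, E) 𝓘(ℝ, E') p x))
    (hreal : IsCompletelyRealSubspace (leafTangent E E' p x))
    {c : BivectorField ℂ E M} (hc : Bivector.IsNondegenerate20 (c x)) :
    Function.Injective
      (Bivector.complexify (pushAt (E' := E') p (fun y => Bivector.re (c y)) x) +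
        Complex.I • Bivector.complexify
          (pushAt (E' := E') p (fun y => Bivector.im (c y)) x)).1 := by
  rw [pushAt, pushAt, Bivector.complexify_map_re_add_im]
  exact hc.map_injective hp hreal

theorem mainTheorem12_general [FiniteDimensional ℝ E'] {c : BivectorField ℂ E M}
    (hc : ∀ x, Bivector.IsNondegenerate20 (c x)) {p : M → M'} (hp : IsFibration E E' p)
    (hproj : IsProjectablePair E' p hp.surjective
      (fun x => Bivector.re (c x)) (fun x => Bivector.im (c x)))
    (hreal : IsCompletelyReal E E' p)
    (hnontrivial : (reduction p hp.surjective
      (fun x => Bivector.re (c x)) (fun x => Bivector.im (c x)) :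
        Submodule ℝ (BivectorField ℝ E' M')) ≠ ⊥) (x' : M') :
    ¬ IsCompleteStructureAt (reduction p hp.surjective
      (fun x => Bivector.re (c x)) (fun x => Bivector.im (c x)) :
        Submodule ℝ (BivectorField ℝ E' M')) x' := by
  rcases hproj.2.2 with hli | ⟨hzero₁, hzero₂⟩
  · obtain ⟨x, rfl, hx⟩ := exists_pushforward_eq_pushAt (E' := E') (E := E) hp.surjective x'
    apply not_isCompleteStructureAt_pencil hli
    rw [hx, hx]
    exact complexify_pushAt_re_add_im_injective (hp.submersion x) (hreal x) (hc x)
  · exact absurd (by simp [reduction, pencil, hzero₁, hzero₂]) hnontrivial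

end Reduction

theorem mainTheorem12
    {E : Type*} [NormedAddCommGroup E] [NormedSpace ℂ E] [FiniteDimensional ℂ E]
    {M : Type*} [TopologicalSpace M] [ChartedSpace E M] [IsManifold 𝓘(ℂ, E) ω M]
    {E' : Type*} [NormedAddCommGroup E'] [NormedSpace ℝ E'] [FiniteDimensional ℝ E']
    {M' : Type*} [TopologicalSpace M'] [ChartedSpace E' M'] [IsManifold 𝓘(ℝ, E') ∞ M']
    (Ω : ∀ x : M, TangentSpace 𝓘(ℂ, E) x [⋀^Fin 2]→L[ℂ] ℂ)
    (hΩ : IsHolomorphicSymplectic Ω)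
    (p : M → M') (hp : IsFibration E E' p)
    (hproj : IsProjectablePair E' p hp.surjective (reInverseField Ω hΩ) (imInverseField Ω hΩ))
    (hreal : IsCompletelyReal E E' p)
    (hnontrivial : (reduction p hp.surjective (reInverseField Ω hΩ) (imInverseField Ω hΩ) :
      Submodule ℝ (BivectorField ℝ E' M')) ≠ ⊥) :
    ¬ IsCompleteStructure (reduction p hp.surjective (reInverseField Ω hΩ) (imInverseField Ω hΩ) :
      Submodule ℝ (BivectorField ℝ E' M')) :=
  fun hcomplete =>
    have ⟨x', hx'⟩ := hcomplete.exists_isCompleteStructureAt hnontrivial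
    mainTheorem12_general (fun _ => Bivector.isNondegenerate20_inverse (V := E) _ _ _)
      hp hproj hreal hnontrivial x' hx'
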